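/- **Theorem (Progress and deadlock freedom for HCP).** *Terms.* Fix a countably infinite set of names (channel endpoints). Processes are $$P,Q ::= x{\leftrightarrow}y \mid \mathbf 0 \mid (\nu xx')P \mid (P\mid Q) \mid x[y].P \mid x(y).P \mid x[\,].P \mid x(\,).P \mid x\triangleleft\mathtt{inl}.P \mid x\triangleleft\mathtt{inr}.P \mid x\triangleright\{\mathtt{inl}{:}P;\mathtt{inr}{:}Q\} \mid x\triangleright\{\},$$ where $x,x'$ are bound in $(\nu xx')P$ and $y$ is bound in $x[y].P$ and $x(y).P$; processes are considered up to renaming of bound names. Structural congruence $\equiv$ is the least congruence with $x{\leftrightarrow}y\equiv y{\leftrightarrow}x$; $P\mid Q\equiv Q\mid P$; $P\mid(Q\mid R)\equiv(P\mid Q)\mid R$; $P\mid\mathbf 0\equiv P$; $(\nu xx')\mathbf 0\equiv\mathbf 0$; $(\nu xx')P\equiv(\nu x'x)P$; $(\nu xx')(\nu yy')P\equiv(\nu yy')(\nu xx')P$ (for $\{x,x'\}\cap\{y,y'\}=\varnothing$); $(\nu xx')(P\mid Q)\equiv P\mid(\nu xx')Q$ if $x,x'$ are not free in $P$. *Types.*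 $A,B ::= A\otimes B\mid 1\mid A\wp B\mid\bot\mid A\oplus B\mid 0\mid A\& B\mid\top$, with the duality $(\cdot)^\bot$ that exchanges $\otimes/\wp$, $1/\bot$, $\oplus/\&$, $0/\top$ and is applied to the immediate subformulas. An environment $\Gamma$ is a finite multiset of typed names $x{:}A$; a hyper-environment $\mathcal G=\Gamma_1\parallel\dots\parallel\Gamma_k$ is a finite multiset of environments ($\varnothing$ if $k=0$), all of whose names are pairwise distinct. The judgement $P\vdash\mathcal G$ is defined by the rules below, in which every hyper-environment written is assumed to have pairwise distinct names: - $x{\leftrightarrow}y\vdash x{:}A,y{:}A^\bot$; $\ \mathbf 0\vdash\varnothing$; if $P\vdash\mathcal G$ and $Q\vdash\mathcal H$ then $P\mid Q\vdash\mathcal G\parallel\mathcal H$; if $P\vdash\mathcal G\parallel\Gamma,x{:}A\parallel\Delta,x'{:}A^\bot$ then $(\nu xx')P\vdash\mathcal G\parallel\Gamma,\Delta$; - if $P\vdash\Gamma,y{:}A\parallel\Delta,x{:}B$ then $x[y].P\vdash\Gamma,\Delta,x{:}A\otimes B$; if $P\vdash\Gamma,y{:}A,x{:}B$ then $x(y).P\vdash\Gamma,x{:}A\wp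 B$; if $P\vdash\varnothing$ then $x[\,].P\vdash x{:}1$; if $P\vdash\Gamma$ then $x(\,).P\vdash\Gamma,x{:}\bot$; - if $P\vdash\Gamma,x{:}A$ then $x\triangleleft\mathtt{inl}.P\vdash\Gamma,x{:}A\oplus B$; if $P\vdash\Gamma,x{:}B$ then $x\triangleleft\mathtt{inr}.P\vdash\Gamma,x{:}A\oplus B$; if $P\vdash\Gamma,x{:}A$ and $Q\vdash\Gamma,x{:}B$ then $x\triangleright\{\mathtt{inl}{:}P;\mathtt{inr}{:}Q\}\vdash\Gamma,x{:}A\& B$; $\ x\triangleright\{\}\vdash\Gamma,x{:}\top$. *Reduction.* $\Longrightarrow$ is the least relation with $(\nu xx')(w{\leftrightarrow}x\mid P)\Longrightarrow P\{w/x'\}$; $(\nu xx')(x[y].P\mid x'(y').R)\Longrightarrow(\nu xx')(\nu yy')(P\mid R)$ (bound names chosen so that nothing is captured); $(\nu xx')(x[\,].P\mid x'(\,).Q)\Longrightarrow P\mid Q$; $(\nu xx')(x\triangleleft\mathtt{inl}.P\mid x'\triangleright\{\mathtt{inl}{:}Q;\mathtt{inr}{:}R\})\Longrightarrow(\nu xx')(P\mid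 Q)$; $(\nu xx')(x\triangleleft\mathtt{inr}.P\mid x'\triangleright\{\mathtt{inl}{:}Q;\mathtt{inr}{:}R\})\Longrightarrow(\nu xx')(P\mid R)$; closed under $(\nu xx')[\cdot]$, under $[\cdot]\mid Q$, and under $\equiv$ on both sides. *Canonical forms.* $x{\leftrightarrow}y$ acts on $x$ and $y$; a process whose outermost constructor is a prefix, selection or choice with subject $x$ acts on $x$; $\mathbf 0$, cuts $(\nu xx')P$ and mixes $P\mid Q$ act on nothing. A canonical form is a process $$(\nu x_1x_1')\cdots(\nu x_nx_n')(P_1\mid\dots\mid P_{n+m+1}),\qquad n,m\ge 0,$$ with $x_1,x_1',\dots,x_n,x_n'$ pairwise distinct, such that no $P_i$ is a cut or a mix, no $P_i$ is a link acting on some $x_j$ or $x_j'$, and no two processes $P_i,P_j$ ($i\ne j$) act on the two endpoints $x_k,x_k'$ of the same channel. A process is in canonical form if it is structurally congruent to a canonical form. *Claim.* Let $P\vdash\mathcal G$. Then: 1. (Progress) $P$ is in canonical form, or there is a process $Q$ with $P\Longrightarrow Q$. 2. (Blocked canonical forms) If $\mathcal G\neq\varnothing$, then in every canonical form $(\nu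 x_1x_1')\cdots(\nu x_nx_n')(P_1\mid\dots\mid P_{n+m+1})$ that is structurally congruent to $P$, at least one $P_i$ acts on a free name, i.e. on a name different from $x_1,x_1',\dots,x_n,x_n'$. Consequently a well-typed process with $\mathcal G\ne\varnothing$ either reduces or is blocked on an external communication. -/

import Mathlib

namespace HCP

/-- Names of channel endpoints: a countably infinite set with decidable equality. -/
abbrev Name : Type := ℕ

/-- Session types, i.e. propositions of multiplicative-additive linear logic. -/
inductive Ty : Type
  | tensor (A B : Ty)
  | one
  | parr (A B : Ty)
  | bot
  | plus (A B : Ty)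
  | zero
  | amp (A B : Ty)
  | top

/-- Duality of types. -/
def Ty.dual : Ty → Ty
  | .tensor A B => .parr A.dual B.dual
  | .one => .bot
  | .parr A B => .tensor A.dual B.dual
  | .bot => .one
  | .plus A B => .amp A.dual B.dual
  | .zero => .top
  | .amp A B => .plus A.dual B.dual
  | .top => .zero

/-- Raw process terms. The names `x` and `x'` are bound in `P` in `new x x' P`, and `y` is bound
in `P` in `send x y P` and `recv x y P`. -/
inductive Proc : Type
  /-- link `x ↔ y` -/
  | link (x y : Name)
  /-- terminated process `0` -/
  | halt
  /-- name restriction (cut) `(ν x x') P` -/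
  | new (x x' : Name) (P : Proc)
  /-- parallel composition (mix) `P | Q` -/
  | par (P Q : Proc)
  /-- bound output `x[y].P` -/
  | send (x y : Name) (P : Proc)
  /-- input `x(y).P` -/
  | recv (x y : Name) (P : Proc)
  /-- empty output `x[].P` -/
  | close (x : Name) (P : Proc)
  /-- empty input `x().P` -/
  | wait (x : Name) (P : Proc)
  /-- select left -/
  | inl (x : Name) (P : Proc)
  /-- select right -/
  | inr (x : Name) (P : Proc)
  /-- offer a binary choice `x ▷ {inl: P; inr: Q}` -/
  | offer (x : Name) (P Q : Proc)
  /-- offer the nullary choice `x ▷ {}` -/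
  | absurd (x : Name)

namespace Proc

/-- Free names. -/
def fn : Proc → Finset Name
  | link x y => {x, y}
  | halt => ∅
  | new x x' P => P.fn \ {x, x'}
  | par P Q => P.fn ∪ Q.fn
  | send x y P => {x} ∪ (P.fn \ {y})
  | recv x y P => {x} ∪ (P.fn \ {y})
  | close x P => {x} ∪ P.fn
  | wait x P => {x} ∪ P.fn
  | inl x P => {x} ∪ P.fn
  | inr x P => {x} ∪ P.fn
  | offer x P Q => {x} ∪ (P.fn ∪ Q.fn)
  | absurd x => {x}

/-- Apply a permutation of names to all names of a term, free, bound and binding. -/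
def perm (π : Equiv.Perm Name) : Proc → Proc
  | link x y => link (π x) (π y)
  | halt => halt
  | new x x' P => new (π x) (π x') (P.perm π)
  | par P Q => par (P.perm π) (Q.perm π)
  | send x y P => send (π x) (π y) (P.perm π)
  | recv x y P => recv (π x) (π y) (P.perm π)
  | close x P => close (π x) (P.perm π)
  | wait x P => wait (π x) (P.perm π)
  | inl x P => inl (π x) (P.perm π)
  | inr x P => inr (π x) (P.perm π)
  | offer x P Q => offer (π x) (P.perm π) (Q.perm π)
  | absurd x => absurd (π x)

/-- Exchange the names `x` and `y` throughout a term. -/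
def swap (x y : Name) (P : Proc) : Proc := P.perm (Equiv.swap x y)

/-- A name outside the finite set `S`. -/
def fresh (S : Finset Name) : Name := S.sup id + 1

/-- Simultaneous capture-avoiding renaming: each free name `a` is replaced by `ρ a`, and each bound
name is replaced by one that is different from all the names `ρ a` with `a` free below the
binder. -/
def rename (ρ : Name → Name) : Proc → Proc
  | link x y => link (ρ x) (ρ y)
  | halt => halt
  | new x x' P =>
      let S := (P.fn \ {x, x'}).image ρ
      let z := fresh S
      let z' := fresh (insert z S)
      new z z' (P.rename (Function.update (Function.update ρ x z) x' z'))
  | par P Q => par (P.rename ρ) (Q.rename ρ)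
  | send x y P =>
      let z := fresh ((P.fn \ {y}).image ρ)
      send (ρ x) z (P.rename (Function.update ρ y z))
  | recv x y P =>
      let z := fresh ((P.fn \ {y}).image ρ)
      recv (ρ x) z (P.rename (Function.update ρ y z))
  | close x P => close (ρ x) (P.rename ρ)
  | wait x P => wait (ρ x) (P.rename ρ)
  | inl x P => inl (ρ x) (P.rename ρ)
  | inr x P => inr (ρ x) (P.rename ρ)
  | offer x P Q => offer (ρ x) (P.rename ρ) (Q.rename ρ)
  | absurd x => absurd (ρ x)

/-- Capture-avoiding substitution `P{w/x}` of the name `w` for the free name `x`. -/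
def subst (w x : Name) (P : Proc) : Proc := P.rename (Function.update id x w)

end Proc

open Proc

/-- The congruence closure of a relation on terms: the smallest equivalence relation that contains
it and is compatible with all term constructors. -/
inductive CongClosure (r : Proc → Proc → Prop) : Proc → Proc → Prop
  | base {P Q} : r P Q → CongClosure r P Q
  | refl (P) : CongClosure r P P
  | symm {P Q} : CongClosure r P Q → CongClosure r Q P
  | trans {P Q R} : CongClosure r P Q → CongClosure r Q R → CongClosure r P R
  | new {x x' P Q} : CongClosure r P Q → CongClosure r (new x x' P) (new x x' Q)
  | par {P P' Q Q'} : CongClosure r P P' → CongClosure r Q Q' →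
      CongClosure r (par P Q) (par P' Q')
  | send {x y P Q} : CongClosure r P Q → CongClosure r (send x y P) (send x y Q)
  | recv {x y P Q} : CongClosure r P Q → CongClosure r (recv x y P) (recv x y Q)
  | close {x P Q} : CongClosure r P Q → CongClosure r (close x P) (close x Q)
  | wait {x P Q} : CongClosure r P Q → CongClosure r (wait x P) (wait x Q)
  | inl {x P Q} : CongClosure r P Q → CongClosure r (inl x P) (inl x Q)
  | inr {x P Q} : CongClosure r P Q → CongClosure r (inr x P) (inr x Q)
  | offer {x P P' Q Q'} : CongClosure r P P' → CongClosure r Q Q' →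
      CongClosure r (offer x P Q) (offer x P' Q')

/-- Renaming of one bound name at the root of a term. -/
inductive AlphaStep : Proc → Proc → Prop
  | new_left {x x' y P} : x ≠ x' → y ≠ x' → y ∉ P.fn →
      AlphaStep (new x x' P) (new y x' (swap x y P))
  | new_right {x x' y P} : x ≠ x' → y ≠ x → y ∉ P.fn →
      AlphaStep (new x x' P) (new x y (swap x' y P))
  | send {x y z P} : z ∉ P.fn → AlphaStep (send x y P) (send x z (swap y z P))
  | recv {x y z P} : z ∉ P.fn → AlphaStep (recv x y P) (recv x z (swap y z P))

/-- α-equivalence: the terms of the calculus are raw terms up to renaming of bound names. -/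
def AlphaEq : Proc → Proc → Prop := CongClosure AlphaStep

/-- The axioms of structural congruence. In `new_comm` the two pairs of binders do not shadow each
other. By `new_swap` the two endpoints in a restriction form an unordered pair. -/
inductive StructAxiom : Proc → Proc → Prop
  | link_comm {x y} : StructAxiom (link x y) (link y x)
  | mix_comm {P Q} : StructAxiom (par P Q) (par Q P)
  | mix_assoc {P Q R} : StructAxiom (par P (par Q R)) (par (par P Q) R)
  | mix_halt {P} : StructAxiom (par P halt) P
  | new_halt {x x'} : StructAxiom (new x x' halt) halt
  | new_swap {x x' P} : StructAxiom (new x x' P) (new x' x P)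
  | new_comm {x x' y y' P} : x ≠ y → x ≠ y' → x' ≠ y → x' ≠ y' →
      StructAxiom (new x x' (new y y' P)) (new y y' (new x x' P))
  | scope_ext {x x' P Q} : x ∉ P.fn → x' ∉ P.fn →
      StructAxiom (new x x' (par P Q)) (par P (new x x' Q))

/-- Structural congruence `P ≡ Q`, on terms up to α-equivalence. -/
def StructEq : Proc → Proc → Prop :=
  CongClosure (fun P Q => AlphaStep P Q ∨ StructAxiom P Q)

/-- Reduction `P ⟹ Q`. The side conditions of `beta_tensor_parr` say that the bound names `y` and
`y'` have been chosen so that no name is captured; this can always be achieved by α-equivalence,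
which is part of structural congruence. -/
inductive Red : Proc → Proc → Prop
  | link {w x x' P} : Red (new x x' (par (link w x) P)) (subst w x' P)
  | beta_tensor_parr {x x' y y' P R} :
      y ≠ y' → y ≠ x → y ≠ x' → y' ≠ x → y' ≠ x' → y ∉ R.fn → y' ∉ P.fn →
      Red (new x x' (par (send x y P) (recv x' y' R))) (new x x' (new y y' (par P R)))
  | beta_one_bot {x x' P Q} : Red (new x x' (par (close x P) (wait x' Q))) (par P Q)
  | beta_plus_with_left {x x' P Q R} :
      Red (new x x' (par (inl x P) (offer x' Q R))) (new x x' (par P Q))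
  | beta_plus_with_right {x x' P Q R} :
      Red (new x x' (par (inr x P) (offer x' Q R))) (new x x' (par P R))
  | new {x x' P P'} : Red P P' → Red (new x x' P) (new x x' P')
  | mix {P P' Q} : Red P P' → Red (par P Q) (par P' Q)
  | equiv {P Q Q' P'} : StructEq P Q → Red Q Q' → StructEq Q' P' → Red P P'

/-- Environments `x₁ : A₁, …, xₙ : Aₙ`. -/
abbrev Env : Type := Multiset (Name × Ty)

/-- Hyper-environments: multisets of environments. -/
abbrev HyperEnv : Type := Multiset Env

/-- The names of an environment, with multiplicity. -/
def Env.names (Γ : Env) : Multiset Name := Γ.map Prod.fst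

/-- The names of a hyper-environment, with multiplicity. -/
def HyperEnv.names (G : HyperEnv) : Multiset Name := (G.map Env.names).sum

/-- `Typed P G` is the judgement `P ⊢ G`. The side conditions on names in `ax`, `mix`, `bot` and
`top` are exactly what is needed to keep all the names in every derivable hyper-environment
pairwise distinct (see `Typed.nodup_names`). The rule `alpha` says that typing is about terms up to
α-equivalence. There is no rule for the type `zero`. -/
inductive Typed : Proc → HyperEnv → Prop
  | ax {x y A} : x ≠ y → Typed (link x y) {{(x, A), (y, A.dual)}}
  | cut {x x' P A} {Γ Δ : Env} {G : HyperEnv} :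
      Typed P (G + {Γ + {(x, A)}} + {Δ + {(x', A.dual)}}) →
      Typed (new x x' P) (G + {Γ + Δ})
  | mix {P Q} {G H : HyperEnv} : Typed P G → Typed Q H → Disjoint G.names H.names →
      Typed (par P Q) (G + H)
  | mix_zero : Typed halt 0
  | tensor {x y P A B} {Γ Δ : Env} :
      Typed P ({Γ + {(y, A)}} + {Δ + {(x, B)}}) →
      Typed (send x y P) {Γ + Δ + {(x, .tensor A B)}}
  | parr {x y P A B} {Γ : Env} :
      Typed P {Γ + {(y, A)} + {(x, B)}} →
      Typed (recv x y P) {Γ + {(x, .parr A B)}}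
  | one {x P} : Typed P 0 → Typed (close x P) {{(x, .one)}}
  | bot {x P} {Γ : Env} : Typed P {Γ} → x ∉ Γ.names →
      Typed (wait x P) {Γ + {(x, .bot)}}
  | plus_left {x P A B} {Γ : Env} : Typed P {Γ + {(x, A)}} →
      Typed (inl x P) {Γ + {(x, .plus A B)}}
  | plus_right {x P A B} {Γ : Env} : Typed P {Γ + {(x, B)}} →
      Typed (inr x P) {Γ + {(x, .plus A B)}}
  | amp {x P Q A B} {Γ : Env} : Typed P {Γ + {(x, A)}} → Typed Q {Γ + {(x, B)}} →
      Typed (offer x P Q) {Γ + {(x, .amp A B)}}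
  | top {x} {Γ : Env} : Γ.names.Nodup → x ∉ Γ.names →
      Typed (absurd x) {Γ + {(x, .top)}}
  | alpha {P Q G} : AlphaEq P Q → Typed P G → Typed Q G

/-- The names in a derivable hyper-environment are pairwise distinct. -/
theorem Typed.nodup_names {P : Proc} {G : HyperEnv} (h : Typed P G) : G.names.Nodup := by
  induction h <;> simp_all [HyperEnv.names, Env.names, Multiset.nodup_add]

/-- The names on which a process acts: those free in its outermost constructor, if this is neither
a restriction, a parallel composition, nor the terminated process. -/
def Proc.acts : Proc → Finset Name
  | link x y => {x, y}
  | halt => ∅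
  | new _ _ _ => ∅
  | par _ _ => ∅
  | send x _ _ => {x}
  | recv x _ _ => {x}
  | close x _ => {x}
  | wait x _ => {x}
  | inl x _ => {x}
  | inr x _ => {x}
  | offer x _ _ => {x}
  | absurd x => {x}

/-- `P₁ | (P₂ | … | Pₖ)`. -/
def parList : List Proc → Proc
  | [] => halt
  | [P] => P
  | P :: Q :: Ps => par P (parList (Q :: Ps))

/-- `(ν x₁ x₁') … (ν xₙ xₙ') P`. -/
def newList : List (Name × Name) → Proc → Proc
  | [], P => P
  | (x, x') :: bs, P => new x x' (newList bs P)

/-- The names bound by the prefix `(ν x₁ x₁') … (ν xₙ xₙ')`. -/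
def boundNames (bs : List (Name × Name)) : List Name := bs.flatMap (fun b => [b.1, b.2])

/-- `IsCanonicalForm bs Ps` says that `(ν x₁ x₁') … (ν xₙ xₙ') (P₁ | … | Pₖ)`, where `bs` is the
list of the pairs `(xᵢ, xᵢ')` and `Ps` is the list of the `Pᵢ`, is a canonical form. -/
structure IsCanonicalForm (bs : List (Name × Name)) (Ps : List Proc) : Prop where
  /-- the bound names are pairwise distinct -/
  nodup : (boundNames bs).Nodup
  /-- there are `k = n + m + 1` processes, for some natural number `m` -/
  card : ∃ m : ℕ, Ps.length = bs.length + m + 1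
  /-- no process is a cut -/
  not_cut : ∀ x x' P, new x x' P ∉ Ps
  /-- no process is a mix -/
  not_mix : ∀ P Q, par P Q ∉ Ps
  /-- no process is a link acting on a bound name -/
  not_link : ∀ x y, link x y ∈ Ps → x ∉ boundNames bs ∧ y ∉ boundNames bs
  /-- no two processes act on the two endpoints of the same channel -/
  not_dual : ∀ x x', (x, x') ∈ bs → ∀ i j : Fin Ps.length, i ≠ j →
    ¬ (x ∈ (Ps.get i).acts ∧ x' ∈ (Ps.get j).acts)

/-- A process is in canonical form if it is structurally congruent to a canonical form. -/
def Canonical (P : Proc) : Prop :=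
  ∃ bs Ps, IsCanonicalForm bs Ps ∧ StructEq P (newList bs (parList Ps))

end HCP

namespace HCP

/-! The two claims have separate proofs.

Blocked canonical forms are a counting argument. In a typed process the used cuts plus the
environments number at most the nonzero parallel components: a cut merges two environments, so it
spends one and adds at most one used cut (`Typed.invariants`). Structural congruence preserves both
counts and the disjointness of parallel components (`StructEq.invariants`). If every component of a
canonical form acted only on bound names, sending each nonzero component to a channel it acts on
would be injective: two components sharing an endpoint violate linearity, two on opposite endpoints
violate canonicity. So components would not exceed used cuts (`IsCanonicalForm.components_le`),
which leaves no room for an environment.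

Progress needs no counting. A typed process is congruent to a prenex form, all unguarded cuts in
front of components that are not cuts or mixes, together with one global map from names to types
that gives dual types to the two ends of each channel and fits the head of each component
(`Typed.exists_isPrenex`). Only heads matter, since a single reduction looks no deeper. If this form
is not canonical, then a link acts on a bound name (`reducible_link`), or two components act on the
two ends of a channel and, by duality, have matching heads (`reducible_of_dual`). -/

open Proc

/-! ### Counting invariants and linearity -/

namespace Proc

/-- The number of parallel components other than `0`, looking through restrictions. -/
def components : Proc → ℕ
  | halt => 0
  | new _ _ P => P.components
  | par P Q => P.components + Q.components
  | _ => 1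

/-- The number of unguarded restrictions that bind at least one free name of their body. -/
def usedCuts : Proc → ℕ
  | new x x' P => P.usedCuts + if x ∈ P.fn ∨ x' ∈ P.fn then 1 else 0
  | par P Q => P.usedCuts + Q.usedCuts
  | _ => 0

/-- Unguarded parallel components share no free name. -/
def Linear : Proc → Prop
  | new _ _ P => P.Linear
  | par P Q => P.Linear ∧ Q.Linear ∧ Disjoint P.fn Q.fn
  | _ => True

theorem mem_fn_perm (π : Equiv.Perm Name) (P : Proc) (a : Name) :
    a ∈ (P.perm π).fn ↔ π.symm a ∈ P.fn := by
  induction P <;> simp_all [perm, fn, Equiv.symm_apply_eq]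

theorem components_perm (π : Equiv.Perm Name) (P : Proc) :
    (P.perm π).components = P.components := by
  induction P <;> simp_all [perm, components]

theorem usedCuts_perm (π : Equiv.Perm Name) (P : Proc) :
    (P.perm π).usedCuts = P.usedCuts := by
  induction P <;> simp_all [perm, usedCuts, mem_fn_perm]

theorem linear_perm (π : Equiv.Perm Name) (P : Proc) :
    (P.perm π).Linear ↔ P.Linear := by
  induction P <;> simp_all [perm, Linear, mem_fn_perm, Finset.disjoint_left]
  intro _ _
  exact ⟨fun h a ha => by simpa using h (a := π a) (by simpa using ha), fun h a ha => h ha⟩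

theorem mem_fn_swap {x y : Name} {P : Proc} {a : Name} :
    a ∈ (swap x y P).fn ↔ Equiv.swap x y a ∈ P.fn := by
  rw [swap, mem_fn_perm, Equiv.symm_swap]

theorem acts_subset_fn (P : Proc) : P.acts ⊆ P.fn := by
  cases P <;> simp [acts, fn]

end Proc

theorem AlphaStep.fn_eq {P Q : Proc} (h : AlphaStep P Q) : P.fn = Q.fn := by
  cases h <;> ext a <;> simp only [fn, Finset.mem_sdiff, Finset.mem_insert, Finset.mem_singleton,
    mem_fn_swap, Finset.mem_union, Equiv.swap_apply_def] <;> grind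

theorem AlphaStep.usedCuts_eq {P Q : Proc} (h : AlphaStep P Q) : P.usedCuts = Q.usedCuts := by
  cases h with
  | send | recv => rfl
  | new_left | new_right =>
    simp only [usedCuts, mem_fn_swap, Equiv.swap_apply_def]
    rw [swap, usedCuts_perm]
    grind

/-- Structural congruence preserves free names, components, used cuts and linearity. -/
theorem StructEq.invariants {P Q : Proc} (h : StructEq P Q) :
    P.fn = Q.fn ∧ P.components = Q.components ∧ P.usedCuts = Q.usedCuts ∧
      (P.Linear ↔ Q.Linear) := by
  -- The four invariants go by one induction: congruence under a restriction needs equal free names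
  -- for `usedCuts`, and congruence under a mix needs them for `Linear`.
  induction h with
  | base h =>
    rcases h with h | h
    · refine ⟨h.fn_eq, ?_, h.usedCuts_eq, ?_⟩ <;>
        cases h <;> simp [components, Linear, swap, components_perm, linear_perm]
    · cases h with
      | link_comm => simp [fn, components, usedCuts, Linear, Finset.pair_comm]
      | mix_comm =>
        simp [fn, components, usedCuts, Linear, Finset.union_comm, add_comm, disjoint_comm]
        tauto
      | mix_assoc =>
        simp [fn, components, usedCuts, Linear, add_assoc]
        tauto
      | mix_halt => simp [fn, components, usedCuts, Linear]
      -- This axiom deletes a restriction, which is why only restrictions binding a name that occurs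
      -- free are counted.
      | new_halt => simp [fn, components, usedCuts, Linear]
      | new_swap => simp [fn, components, usedCuts, Linear, Finset.pair_comm, or_comm]
      | new_comm h1 h2 h3 h4 =>
        refine ⟨?_, rfl, ?_, Iff.rfl⟩
        · ext a; simp [fn]; tauto
        · simp [fn, usedCuts]; grind
      | scope_ext h1 h2 =>
        refine ⟨?_, rfl, ?_, ?_⟩
        · ext a; simp [fn]; grind
        · simp [fn, usedCuts, h1, h2]; omega
        · simp only [fn, Linear, Finset.disjoint_left, Finset.mem_sdiff, Finset.mem_insert,
            Finset.mem_singleton]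
          grind
  | refl => exact ⟨rfl, rfl, rfl, Iff.rfl⟩
  | symm _ ih => exact ⟨ih.1.symm, ih.2.1.symm, ih.2.2.1.symm, ih.2.2.2.symm⟩
  | trans _ _ ih1 ih2 =>
    exact ⟨ih1.1.trans ih2.1, ih1.2.1.trans ih2.2.1, ih1.2.2.1.trans ih2.2.2.1,
      ih1.2.2.2.trans ih2.2.2.2⟩
  | _ => simp_all [fn, components, usedCuts, Linear]

theorem CongClosure.mono {r s : Proc → Proc → Prop} (hrs : ∀ P Q, r P Q → s P Q) {P Q : Proc}
    (h : CongClosure r P Q) : CongClosure s P Q := by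
  induction h with
  | base h => exact .base (hrs _ _ h)
  | refl => exact .refl _
  | symm _ ih => exact .symm ih
  | trans _ _ ih1 ih2 => exact .trans ih1 ih2
  | new _ ih => exact .new ih
  | par _ _ ih1 ih2 => exact .par ih1 ih2
  | send _ ih => exact .send ih
  | recv _ ih => exact .recv ih
  | close _ ih => exact .close ih
  | wait _ ih => exact .wait ih
  | inl _ ih => exact .inl ih
  | inr _ ih => exact .inr ih
  | offer _ _ ih1 ih2 => exact .offer ih1 ih2

theorem AlphaEq.structEq {P Q : Proc} (h : AlphaEq P Q) : StructEq P Q :=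
  CongClosure.mono (fun _ _ => Or.inl) h

theorem StructAxiom.structEq {P Q : Proc} (h : StructAxiom P Q) : StructEq P Q := .base (.inr h)

theorem AlphaStep.structEq {P Q : Proc} (h : AlphaStep P Q) : StructEq P Q := .base (.inl h)

/-- The rule for ⊤ admits names that do not occur in the process. Hence free names are only included
in the typed names, and a typed cut may be unused, so the count is an inequality. -/
theorem Typed.invariants {P : Proc} {G : HyperEnv} (h : Typed P G) :
    (∀ a ∈ P.fn, a ∈ G.names) ∧ P.usedCuts + G.card ≤ P.components ∧ P.Linear := by
  induction h with
  | @cut x x' P A Γ Δ G h ih =>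
    obtain ⟨h1, h2, h3⟩ := ih
    refine ⟨?_, ?_, h3⟩
    · intro a ha
      simp [fn] at ha
      have := h1 a ha.1
      simp [HyperEnv.names, Env.names] at this ⊢
      grind
    -- The number of environments drops by one, while the used cuts grow by zero or one.
    · simp [usedCuts, components] at h2 ⊢
      split_ifs <;> omega
  | @mix P Q G H hP hQ hd ihP ihQ =>
    refine ⟨?_, ?_, ihP.2.2, ihQ.2.2, ?_⟩
    · intro a ha
      have h1 := ihP.1 a
      have h2 := ihQ.1 a
      simp [fn, HyperEnv.names] at ha h1 h2 ⊢
      tauto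
    · have h1 := ihP.2.1
      have h2 := ihQ.2.1
      simp [usedCuts, components]
      omega
    · rw [Finset.disjoint_left]
      intro a ha hb
      exact Multiset.disjoint_left.1 hd (ihP.1 a ha) (ihQ.1 a hb)
  | alpha e _ ih =>
    obtain ⟨h1, h2, h3, h4⟩ := e.structEq.invariants
    rw [← h1, ← h2, ← h3, ← h4]
    exact ih
  | _ =>
    refine ⟨?_, by simp [usedCuts, components], trivial⟩
    simp_all [fn, HyperEnv.names, Env.names]
    try grind

/-! ### Blocked canonical forms -/

theorem fn_parList {Ps : List Proc} {a : Name} :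
    a ∈ (parList Ps).fn ↔ ∃ P ∈ Ps, a ∈ P.fn := by
  induction Ps using parList.induct <;> simp_all [parList, fn]

theorem mem_fn_newList {bs : List (Name × Name)} {P : Proc} {a : Name} :
    a ∈ (newList bs P).fn ↔ a ∈ P.fn ∧ a ∉ boundNames bs := by
  induction bs with
  | nil => simp [newList, boundNames]
  | cons b bs ih => simp_all [newList, fn, boundNames]; tauto

theorem components_newList (bs : List (Name × Name)) (P : Proc) :
    (newList bs P).components = P.components := by
  induction bs <;> simp_all [newList, components]

theorem linear_newList (bs : List (Name × Name)) (P : Proc) :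
    (newList bs P).Linear ↔ P.Linear := by
  induction bs <;> simp_all [newList, Linear]

theorem components_parList (Ps : List Proc) :
    (parList Ps).components = (Ps.map components).sum := by
  induction Ps using parList.induct <;> simp_all [parList, components]

theorem linear_parList {Ps : List Proc} :
    (parList Ps).Linear → Ps.Pairwise (fun P Q => Disjoint P.fn Q.fn) := by
  induction Ps using parList.induct with
  | case1 => simp
  | case2 => simp
  | case3 P Q Ps ih =>
    rw [parList]
    rintro ⟨_, h2, h3⟩
    refine List.pairwise_cons.2 ⟨fun R hR => ?_, ih h2⟩
    rw [Finset.disjoint_left] at h3 ⊢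
    exact fun a ha hR' => h3 ha (fn_parList.2 ⟨R, hR, hR'⟩)

/-- Distinct bound names rule out shadowing, so an endpoint free in `P` is still free just below its
own restriction. -/
theorem le_usedCuts_newList {bs : List (Name × Name)} (hn : (boundNames bs).Nodup) (P : Proc) :
    bs.countP (fun b => b.1 ∈ P.fn ∨ b.2 ∈ P.fn) ≤ (newList bs P).usedCuts := by
  induction bs with
  | nil => simp
  | cons b bs ih =>
    have hb : b.1 ∉ boundNames bs ∧ b.2 ∉ boundNames bs ∧ (boundNames bs).Nodup := by
      simp [boundNames] at hn ⊢
      tauto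
    have := ih hb.2.2
    simp only [List.countP_cons, newList, usedCuts, mem_fn_newList, hb.1, hb.2.1,
      not_false_eq_true, and_true, decide_eq_true_eq]
    omega

/-- Each nonzero component is charged to a channel on which it acts, and no channel is charged
twice. -/
theorem IsCanonicalForm.components_le {bs : List (Name × Name)} {Ps : List Proc}
    (hc : IsCanonicalForm bs Ps) (hl : (parList Ps).Linear)
    (hb : ∀ R ∈ Ps, ∀ a ∈ R.acts, a ∈ boundNames bs) :
    (newList bs (parList Ps)).components ≤ (newList bs (parList Ps)).usedCuts := by
  classical
  refine le_trans ?_ (le_usedCuts_newList hc.nodup _)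
  rw [components_newList, components_parList]
  have hbs : bs.Nodup := by
    have := hc.nodup
    clear hc hb
    induction bs with
    | nil => simp
    | cons b bs ih =>
      simp [boundNames] at this ih ⊢
      refine ⟨fun h => ?_, by tauto⟩
      exact (this.1.2 b.1 b.2 h).1 rfl
  -- Occurrences of `0` act on nothing and count for nothing, so they need no channel.
  have h1 : ∀ R ∈ Ps, R.components ≤ if R.acts.Nonempty then 1 else 0 := by
    intro R hR
    cases R with
    | new => exact absurd hR (hc.not_cut _ _ _)
    | par => exact absurd hR (hc.not_mix _ _)
    | _ => simp [components, acts]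
  have hpw := linear_parList hl
  rw [List.countP_eq_length_filter, ← List.toFinset_card_of_nodup (hbs.filter _)]
  calc (Ps.map components).sum = ∑ i : Fin Ps.length, (Ps.get i).components := by
        rw [← List.sum_ofFn]; congr 1; apply List.ext_get <;> simp
    _ ≤ ∑ i : Fin Ps.length, if (Ps.get i).acts.Nonempty then 1 else 0 :=
        Finset.sum_le_sum fun i _ => h1 _ (List.get_mem _ _)
    _ = (Finset.univ.filter fun i : Fin Ps.length => (Ps.get i).acts.Nonempty).card := by simp
    _ ≤ _ := ?_
  have hex : ∀ i : Fin Ps.length, (Ps.get i).acts.Nonempty →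
      ∃ b ∈ bs, ∃ a ∈ (Ps.get i).acts, a = b.1 ∨ a = b.2 := by
    rintro i ⟨a, ha⟩
    have := hb _ (List.get_mem _ _) a ha
    simp only [boundNames, List.mem_flatMap, List.mem_cons, List.not_mem_nil, or_false] at this
    obtain ⟨b, hbm, hab⟩ := this
    exact ⟨b, hbm, a, ha, hab⟩
  choose! f hf using hex
  refine Finset.card_le_card_of_injOn f ?_ ?_
  · intro i hi
    obtain ⟨hm, a, ha, hab⟩ := hf i (by simpa using hi)
    have : a ∈ (parList Ps).fn := fn_parList.2 ⟨_, List.get_mem _ _, acts_subset_fn _ ha⟩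
    simp only [List.coe_toFinset, List.mem_filter, Set.mem_ofPred_eq, decide_eq_true_eq]
    refine ⟨hm, ?_⟩
    rcases hab with rfl | rfl <;> simp [this]
  · intro i hi j hj hij
    obtain ⟨hm, a, ha, hab⟩ := hf i (by simpa using hi)
    obtain ⟨-, a', ha', hab'⟩ := hf j (by simpa using hj)
    rw [← hij] at hab'
    by_contra hne
    have hd : Disjoint (Ps.get i).fn (Ps.get j).fn := by
      rw [List.pairwise_iff_get] at hpw
      rcases lt_or_gt_of_ne hne with h | h
      · exact hpw i j h
      · exact (hpw j i h).symm
    have hnd := hc.not_dual (f i).1 (f i).2 hm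
    -- Equal endpoints contradict disjointness of free names; opposite endpoints contradict
    -- `not_dual`.
    rcases hab with rfl | rfl <;> rcases hab' with rfl | rfl
    · exact Finset.disjoint_left.1 hd (acts_subset_fn _ ha) (acts_subset_fn _ ha')
    · exact hnd i j hne ⟨ha, ha'⟩
    · exact hnd j i (Ne.symm hne) ⟨ha', ha⟩
    · exact Finset.disjoint_left.1 hd (acts_subset_fn _ ha) (acts_subset_fn _ ha')

/-- Some component of a canonical form of a well-typed process acts on a free name. -/
theorem Typed.exists_acts_free {P : Proc} {G : HyperEnv} (hP : Typed P G) (hG : G ≠ 0)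
    {bs : List (Name × Name)} {Ps : List Proc} (hc : IsCanonicalForm bs Ps)
    (he : StructEq P (newList bs (parList Ps))) :
    ∃ R ∈ Ps, ∃ a ∈ R.acts, a ∉ boundNames bs := by
  by_contra! hb
  obtain ⟨-, h2, h3⟩ := hP.invariants
  obtain ⟨-, e2, e3, e4⟩ := he.invariants
  have := hc.components_le ((linear_newList _ _).1 (e4.1 h3)) hb
  have := Multiset.card_pos.2 hG
  omega

/-! ### Head typing, and congruences on lists of binders and components -/

/-- `Q` is neither a cut nor a mix, and its outermost constructor is the one that introduces the
type assigned by `T` to its subject. -/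
def HeadTyped (T : Name → Ty) : Proc → Prop
  | link _ _ => True
  | halt => True
  | new _ _ _ => False
  | par _ _ => False
  | send x _ _ => ∃ A B, T x = .tensor A B
  | recv x _ _ => ∃ A B, T x = .parr A B
  | close x _ => T x = .one
  | wait x _ => T x = .bot
  | inl x _ => ∃ A B, T x = .plus A B
  | inr x _ => ∃ A B, T x = .plus A B
  | offer x _ _ => ∃ A B, T x = .amp A B
  | .absurd x => T x = .top

theorem HeadTyped.perm {T : Name → Ty} {Q : Proc} (h : HeadTyped T Q) (π : Equiv.Perm Name) :
    HeadTyped (T ∘ π.symm) (Q.perm π) := by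
  cases Q <;> simp_all [HeadTyped, Proc.perm]

theorem HeadTyped.congr {T T' : Name → Ty} {Q : Proc} (h : HeadTyped T Q)
    (hT : ∀ a ∈ Q.acts, T a = T' a) : HeadTyped T' Q := by
  cases Q <;> simp_all [HeadTyped, Proc.acts]

theorem parList_map_perm (π : Equiv.Perm Name) (Ps : List Proc) :
    (parList Ps).perm π = parList (Ps.map (Proc.perm π)) := by
  induction Ps using parList.induct <;> simp_all [parList, Proc.perm]

theorem newList_perm {π : Equiv.Perm Name} {bs : List (Name × Name)}
    (h : ∀ a ∈ boundNames bs, π a = a) (P : Proc) :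
    (newList bs P).perm π = newList bs (P.perm π) := by
  induction bs with
  | nil => rfl
  | cons b bs ih =>
    simp only [boundNames, List.flatMap_cons, List.mem_append] at h
    simp only [newList, Proc.perm]
    rw [ih fun a ha => h a (.inr ha), h b.1 (by simp), h b.2 (by simp)]

theorem newList_append (bs bs' : List (Name × Name)) (P : Proc) :
    newList (bs ++ bs') P = newList bs (newList bs' P) := by
  induction bs <;> simp_all [newList]

theorem StructEq.newList {P Q : Proc} (h : StructEq P Q) (bs : List (Name × Name)) :
    StructEq (newList bs P) (newList bs Q) := by
  induction bs with
  | nil => exact h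
  | cons b bs ih => exact .new ih

theorem structEq_halt_par (P : Proc) : StructEq (par halt P) P :=
  .trans (StructAxiom.mix_comm.structEq) StructAxiom.mix_halt.structEq

theorem structEq_parList_cons (P : Proc) (Ps : List Proc) :
    StructEq (parList (P :: Ps)) (par P (parList Ps)) := by
  cases Ps with
  | nil => exact .symm StructAxiom.mix_halt.structEq
  | cons Q Ps => exact .refl _

theorem structEq_parList_append (Ps Qs : List Proc) :
    StructEq (parList (Ps ++ Qs)) (par (parList Ps) (parList Qs)) := by
  induction Ps with
  | nil => exact .symm (structEq_halt_par _)
  | cons P Ps ih =>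
    exact .trans (structEq_parList_cons _ _) <| .trans (.par (.refl _) ih) <|
      .trans StructAxiom.mix_assoc.structEq (.par (.symm (structEq_parList_cons _ _)) (.refl _))

theorem structEq_parList_of_perm {Ps Qs : List Proc} (h : Ps.Perm Qs) :
    StructEq (parList Ps) (parList Qs) := by
  induction h with
  | nil => exact .refl _
  | cons P _ ih =>
    exact .trans (structEq_parList_cons _ _) <| .trans (.par (.refl _) ih) <|
      .symm (structEq_parList_cons _ _)
  | swap P Q Ps =>
    have h (P Q : Proc) : StructEq (parList (P :: Q :: Ps)) (par (par P Q) (parList Ps)) :=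
      .trans (.par (.refl _) (structEq_parList_cons _ _)) StructAxiom.mix_assoc.structEq
    exact .trans (h _ _) <| .trans (.par StructAxiom.mix_comm.structEq (.refl _)) (.symm (h _ _))
  | trans _ _ ih1 ih2 => exact .trans ih1 ih2

theorem structEq_newList_of_perm {bs cs : List (Name × Name)} (h : bs.Perm cs)
    (hn : (boundNames bs).Nodup) (P : Proc) : StructEq (newList bs P) (newList cs P) := by
  induction h with
  | nil => exact .refl _
  | cons b _ ih =>
    refine .new (ih ?_)
    simp only [boundNames, List.flatMap_cons, List.nodup_append] at hn ⊢
    exact hn.2.1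
  | swap b c bs =>
    simp only [boundNames, List.flatMap_cons, List.nodup_append] at hn
    refine StructAxiom.structEq (.new_comm ?_ ?_ ?_ ?_) <;> simp_all
  | trans h1 _ ih1 ih2 =>
    exact .trans (ih1 hn) (ih2 ((List.Perm.flatMap_right _ h1).nodup_iff.1 hn))

theorem structEq_newList_par {bs : List (Name × Name)} {P : Proc}
    (h : ∀ a ∈ boundNames bs, a ∉ P.fn) (Q : Proc) :
    StructEq (newList bs (par P Q)) (par P (newList bs Q)) := by
  induction bs with
  | nil => exact .refl _
  | cons b bs ih =>
    simp only [boundNames, List.flatMap_cons, List.mem_append] at h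
    exact .trans (.new (ih fun a ha => h a (.inr ha)))
      (StructAxiom.scope_ext (h _ (by simp)) (h _ (by simp))).structEq

/-- Mixes of prenex forms with separate names are in prenex form. -/
theorem structEq_par_newList {bs cs : List (Name × Name)} {P Q : Proc}
    (hP : ∀ a ∈ boundNames cs, a ∉ P.fn) (hQ : ∀ a ∈ boundNames bs, a ∉ (newList cs Q).fn) :
    StructEq (par (newList bs P) (newList cs Q)) (newList (bs ++ cs) (par P Q)) := by
  refine .trans StructAxiom.mix_comm.structEq ?_
  refine .trans (.symm (structEq_newList_par hQ _)) ?_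
  rw [newList_append]
  refine StructEq.newList ?_ bs
  exact .trans StructAxiom.mix_comm.structEq (.symm (structEq_newList_par hP _))

/-- Two α-steps merged into one permutation, which can then be pushed through a prenex form at once.
-/
theorem structEq_new_swap_swap {x x' y y' : Name} {P : Proc} (hx : x ≠ x') (hyx' : y ≠ x')
    (hyP : y ∉ P.fn) (hyy' : y' ≠ y) (hyx : y' ≠ x) (hyP' : y' ∉ P.fn) :
    StructEq (new x x' P) (new y y' (P.perm ((Equiv.swap x y).trans (Equiv.swap x' y')))) := by
  have e : P.perm ((Equiv.swap x y).trans (Equiv.swap x' y')) = swap x' y' (swap x y P) := by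
    simp only [swap]
    clear hyP hyP'
    induction P <;> simp_all [Proc.perm]
  rw [e]
  refine .trans (AlphaStep.new_left hx hyx' hyP).structEq
    (AlphaStep.new_right hyx' hyy' ?_).structEq
  rwa [mem_fn_swap, Equiv.swap_apply_of_ne_of_ne hyx hyy']

/-! ### Prenex forms of typed processes -/

theorem exists_type_assignment {Γ : Env} (h : Γ.names.Nodup) :
    ∃ T : Name → Ty, ∀ p ∈ Γ, T p.1 = p.2 := by
  classical
  -- The default `.one` is arbitrary; on names of `Γ` the chosen type is forced by distinctness.
  refine ⟨fun a => if h : ∃ A, (a, A) ∈ Γ then h.choose else .one, ?_⟩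
  rintro ⟨a, A⟩ hp
  have hex : ∃ A, (a, A) ∈ Γ := ⟨A, hp⟩
  simp only [hex, dif_pos]
  exact congrArg Prod.snd (Multiset.inj_on_of_nodup_map h _ hex.choose_spec _ hp rfl)

theorem mem_names {G : HyperEnv} {Γ : Env} {p : Name × Ty} (h : Γ ∈ G) (hp : p ∈ Γ) :
    p.1 ∈ G.names := by
  exact Multiset.mem_join.2 ⟨_, Multiset.mem_map_of_mem _ h, Multiset.mem_map_of_mem _ hp⟩

/-- `newList bs (parList Ps)` is a prenex form whose bound names avoid `S`; `T` assigns dual types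
to the endpoints of its channels, and types to the subjects of its components. -/
structure IsPrenex (S : Finset Name) (T : Name → Ty) (bs : List (Name × Name))
    (Ps : List Proc) : Prop where
  nodup : (boundNames bs).Nodup
  avoids : ∀ a ∈ boundNames bs, a ∉ S
  heads : ∀ R ∈ Ps, HeadTyped T R
  dual : ∀ b ∈ bs, T b.2 = (T b.1).dual

/-- Links and guarded processes are their own prenex form, with no binders. -/
theorem exists_isPrenex_singleton {P : Proc} {Γ : Env} (hn : Γ.names.Nodup)
    (hh : ∀ T : Name → Ty, (∀ p ∈ Γ, T p.1 = p.2) → HeadTyped T P) (S : Finset Name) :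
    ∃ bs Ps T, IsPrenex S T bs Ps ∧ StructEq P (newList bs (parList Ps)) ∧
      ∀ Δ ∈ ({Γ} : HyperEnv), ∀ p ∈ Δ, T p.1 = p.2 := by
  obtain ⟨T, hT⟩ := exists_type_assignment hn
  exact ⟨[], [P], T, ⟨by simp [boundNames], by simp [boundNames], by simpa using hh T hT,
    by simp⟩, .refl _, by simpa using hT⟩

/-- Every well-typed process has a prenex form. -/
theorem Typed.exists_isPrenex {P : Proc} {G : HyperEnv} (h : Typed P G) (S : Finset Name) :
    ∃ bs Ps T, IsPrenex S T bs Ps ∧ StructEq P (newList bs (parList Ps)) ∧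
      ∀ Γ ∈ G, ∀ p ∈ Γ, T p.1 = p.2 := by
  have hnd := h.nodup_names
  induction h generalizing S with
  | alpha e h ih =>
    obtain ⟨bs, Ps, T, h1, h2, h3⟩ := ih S h.nodup_names
    exact ⟨bs, Ps, T, h1, .trans (.symm e.structEq) h2, h3⟩
  | mix_zero =>
    exact ⟨[], [], fun _ => .one, ⟨by simp [boundNames], by simp [boundNames], by simp, by simp⟩,
      .refl _, by simp⟩
  | @mix P Q G H hP hQ hd ihP ihQ =>
    -- The avoided sets keep the binders of each side apart from the names of the other, so scopes
    -- extrude and the two type maps can be glued.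
    obtain ⟨bs, Ps, T, h1, h2, h3⟩ := ihP (S ∪ H.names.toFinset) hP.nodup_names
    obtain ⟨cs, Qs, U, k1, k2, k3⟩ :=
      ihQ (S ∪ G.names.toFinset ∪ (boundNames bs).toFinset) hQ.nodup_names
    have hfP (a : Name) (ha : a ∈ (parList Ps).fn) : a ∈ G.names ∨ a ∈ boundNames bs := by
      by_cases hb : a ∈ boundNames bs
      · exact .inr hb
      · exact .inl (hP.invariants.1 a (h2.invariants.1 ▸ mem_fn_newList.2 ⟨ha, hb⟩))
    have hfQ (a : Name) (ha : a ∈ (parList Qs).fn) : a ∈ H.names ∨ a ∈ boundNames cs := by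
      by_cases hb : a ∈ boundNames cs
      · exact .inr hb
      · exact .inl (hQ.invariants.1 a (k2.invariants.1 ▸ mem_fn_newList.2 ⟨ha, hb⟩))
    have hbs (a : Name) (ha : a ∈ boundNames bs) : a ∉ S ∧ a ∉ H.names := by
      simpa using h1.avoids a ha
    have hcs (a : Name) (ha : a ∈ boundNames cs) :
        a ∉ S ∧ a ∉ G.names ∧ a ∉ boundNames bs := by
      simpa [and_assoc] using k1.avoids a ha
    have hmem (ds : List (Name × Name)) (b : Name × Name) (hb : b ∈ ds) :
        b.1 ∈ boundNames ds ∧ b.2 ∈ boundNames ds := by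
      simp only [boundNames, List.mem_flatMap]
      exact ⟨⟨b, hb, by simp⟩, ⟨b, hb, by simp⟩⟩
    classical
    let V : Name → Ty := fun a => if a ∈ G.names ∨ a ∈ boundNames bs then T a else U a
    have hVT (a : Name) (ha : a ∈ G.names ∨ a ∈ boundNames bs) : V a = T a := if_pos ha
    have hVU (a : Name) (ha : a ∈ H.names ∨ a ∈ boundNames cs) : V a = U a := by
      refine if_neg ?_
      have (h : a ∈ G.names) : a ∉ H.names := Multiset.disjoint_left.1 hd h
      have := hbs a
      have := hcs a
      tauto
    have happ : boundNames (bs ++ cs) = boundNames bs ++ boundNames cs := by simp [boundNames]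
    refine ⟨bs ++ cs, Ps ++ Qs, V, ⟨?_, ?_, ?_, ?_⟩, ?_, ?_⟩
    · rw [happ, List.nodup_append]
      exact ⟨h1.nodup, k1.nodup, fun a ha b hb hab => (hcs b hb).2.2 (hab ▸ ha)⟩
    · intro a ha
      rw [happ, List.mem_append] at ha
      exact ha.elim (fun h => (hbs a h).1) (fun h => (hcs a h).1)
    · intro R hR
      rcases List.mem_append.1 hR with hR | hR
      · refine (h1.heads R hR).congr fun a ha => (hVT a (hfP a ?_)).symm
        exact fn_parList.2 ⟨R, hR, acts_subset_fn R ha⟩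
      · refine (k1.heads R hR).congr fun a ha => (hVU a (hfQ a ?_)).symm
        exact fn_parList.2 ⟨R, hR, acts_subset_fn R ha⟩
    · intro b hb
      rcases List.mem_append.1 hb with hb | hb
      · rw [hVT _ (.inr (hmem _ b hb).1), hVT _ (.inr (hmem _ b hb).2), h1.dual b hb]
      · rw [hVU _ (.inr (hmem _ b hb).1), hVU _ (.inr (hmem _ b hb).2), k1.dual b hb]
    · refine .trans (.par h2 k2) (.trans (structEq_par_newList ?_ ?_)
        (StructEq.newList (.symm (structEq_parList_append _ _)) _))
      · intro a ha hP
        rcases hfP a hP with h | h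
        · exact (hcs a ha).2.1 h
        · exact (hcs a ha).2.2 h
      · intro a ha hQ'
        rw [← k2.invariants.1] at hQ'
        exact (hbs a ha).2 (hQ.invariants.1 a hQ')
    · intro Γ hΓ p hp
      rcases Multiset.mem_add.1 hΓ with h | h
      · rw [hVT _ (.inl (mem_names h hp)), h3 Γ h p hp]
      · rw [hVU _ (.inl (mem_names h hp)), k3 Γ h p hp]
  | @cut x x' P A Γ Δ G hP ih =>
    set G' : HyperEnv := G + {Γ + {(x, A)}} + {Δ + {(x', A.dual)}} with hG'
    have hn := hP.nodup_names
    have hxx : x ≠ x' := by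
      simp [G', HyperEnv.names, Env.names, Multiset.nodup_add] at hn
      grind
    have hxG : x ∉ (G + {Γ + Δ}).names ∧ x' ∉ (G + {Γ + Δ}).names := by
      simp [G', HyperEnv.names, Env.names, Multiset.nodup_add] at hn ⊢
      grind
    -- The endpoints `x`, `x'` may lie in `S`, so the new binder uses fresh names.
    obtain ⟨y, hy⟩ := Infinite.exists_notMem_finset (S ∪ G'.names.toFinset ∪ P.fn)
    obtain ⟨y', hy'⟩ := Infinite.exists_notMem_finset (S ∪ G'.names.toFinset ∪ P.fn ∪ {y})
    simp only [Finset.mem_union, Multiset.mem_toFinset, Finset.mem_singleton, not_or] at hy hy'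
    have hxG' : x ∈ G'.names := by simp [hG', HyperEnv.names, Env.names]
    have hxG'' : x' ∈ G'.names := by simp [hG', HyperEnv.names, Env.names]
    have hsub (a : Name) (ha : a ∈ (G + {Γ + Δ}).names) : a ∈ G'.names := by
      simp [hG', HyperEnv.names, Env.names] at ha ⊢
      tauto
    have hyx : y ≠ x := fun e => hy.1.2 (e ▸ hxG')
    have hyx' : y ≠ x' := fun e => hy.1.2 (e ▸ hxG'')
    have hy'x : y' ≠ x := fun e => hy'.1.1.2 (e ▸ hxG')
    have hy'x' : y' ≠ x' := fun e => hy'.1.1.2 (e ▸ hxG'')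
    -- Avoiding these four names makes `π` fix every inner binder, so only the components and the
    -- type map are permuted.
    obtain ⟨bs, Ps, T, h1, h2, h3⟩ := ih (S ∪ {x, x', y, y'}) hn
    set π : Equiv.Perm Name := (Equiv.swap x y).trans (Equiv.swap x' y') with hπ
    have hfix (a : Name) (h1 : a ≠ x) (h2 : a ≠ x') (h3 : a ≠ y) (h4 : a ≠ y') : π a = a := by
      rw [hπ, Equiv.trans_apply, Equiv.swap_apply_of_ne_of_ne h1 h3,
        Equiv.swap_apply_of_ne_of_ne h2 h4]
    have hav (a : Name) (ha : a ∈ boundNames bs) :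
        a ∉ S ∧ a ≠ x ∧ a ≠ x' ∧ a ≠ y ∧ a ≠ y' := by
      have := h1.avoids a ha
      simp only [Finset.mem_union, Finset.mem_insert, Finset.mem_singleton] at this
      tauto
    have hbfix (a : Name) (ha : a ∈ boundNames bs) : π a = a := by
      obtain ⟨-, h1, h2, h3, h4⟩ := hav a ha
      exact hfix a h1 h2 h3 h4
    have hsymm {a : Name} (ha : π a = a) : π.symm a = a := by rw [Equiv.symm_apply_eq, ha]
    have hπx : π.symm y = x := by
      rw [Equiv.symm_apply_eq, hπ, Equiv.trans_apply, Equiv.swap_apply_left,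
        Equiv.swap_apply_of_ne_of_ne hyx' (Ne.symm hy'.2)]
    have hπx' : π.symm y' = x' := by
      rw [Equiv.symm_apply_eq, hπ, Equiv.trans_apply,
        Equiv.swap_apply_of_ne_of_ne hxx.symm hyx'.symm, Equiv.swap_apply_left]
    refine ⟨(y, y') :: bs, Ps.map (Proc.perm π), T ∘ π.symm, ⟨?_, ?_, ?_, ?_⟩, ?_, ?_⟩
    · have : y ∉ boundNames bs := fun h => (hav y h).2.2.2.1 rfl
      have : y' ∉ boundNames bs := fun h => (hav y' h).2.2.2.2 rfl
      have := h1.nodup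
      have := hy'.2
      change (y :: y' :: boundNames bs).Nodup
      simp only [List.nodup_cons, List.mem_cons]
      tauto
    · change ∀ a ∈ y :: y' :: boundNames bs, a ∉ S
      simp only [List.mem_cons]
      rintro a (rfl | rfl | ha)
      · exact hy.1.1
      · exact hy'.1.1.1
      · exact (hav a ha).1
    · simp only [List.mem_map]
      rintro _ ⟨R, hR, rfl⟩
      exact (h1.heads R hR).perm π
    · intro b hb
      rcases List.mem_cons.1 hb with rfl | hb
      · have e1 := h3 (Γ + {(x, A)}) (by simp [hG']) (x, A) (by simp)
        have e2 := h3 (Δ + {(x', A.dual)}) (by simp [hG']) (x', A.dual) (by simp)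
        simp only [Function.comp_apply, hπx, hπx'] at e1 e2 ⊢
        rw [e1, e2]
      · have m1 : b.1 ∈ boundNames bs := List.mem_flatMap.2 ⟨b, hb, by simp⟩
        have m2 : b.2 ∈ boundNames bs := List.mem_flatMap.2 ⟨b, hb, by simp⟩
        simp only [Function.comp_apply, hsymm (hbfix _ m1), hsymm (hbfix _ m2)]
        exact h1.dual b hb
    · refine .trans (.new h2) ?_
      have hf := h2.invariants.1
      refine .trans (structEq_new_swap_swap hxx hyx' (hf ▸ hy.2) hy'.2 hy'x (hf ▸ hy'.1.2)) ?_
      rw [← hπ, newList_perm hbfix, parList_map_perm]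
      exact .refl _
    · intro Θ hΘ p hp
      have hpn := mem_names hΘ hp
      have hpfix : π p.1 = p.1 := hfix _ (fun e => hxG.1 (e ▸ hpn)) (fun e => hxG.2 (e ▸ hpn))
        (fun e => hy.1.2 (e ▸ hsub _ hpn)) (fun e => hy'.1.1.2 (e ▸ hsub _ hpn))
      simp only [Function.comp_apply, hsymm hpfix]
      rcases Multiset.mem_add.1 hΘ with h | h
      · exact h3 Θ (by simp [hG', h]) p hp
      · rw [Multiset.mem_singleton.1 h] at hp
        rcases Multiset.mem_add.1 hp with h' | h'
        · exact h3 (Γ + {(x, A)}) (by simp [hG']) p (by simp [h'])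
        · exact h3 (Δ + {(x', A.dual)}) (by simp [hG']) p (by simp [h'])
  | ax =>
    refine exists_isPrenex_singleton ?_ ?_ S
    · simpa [HyperEnv.names] using hnd
    · exact fun _ _ => trivial
  | tensor | parr | plus_left | plus_right | amp =>
    refine exists_isPrenex_singleton ?_ ?_ S
    · simpa [HyperEnv.names] using hnd
    · exact fun T hT =>
        ⟨_, _, hT (_, _) (Multiset.mem_add.2 (.inr (Multiset.mem_singleton_self _)))⟩
  | one =>
    refine exists_isPrenex_singleton ?_ ?_ S
    · simpa [HyperEnv.names] using hnd
    · exact fun T hT => hT (_, _) (Multiset.mem_singleton_self _)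
  | bot | top =>
    refine exists_isPrenex_singleton ?_ ?_ S
    · simpa [HyperEnv.names] using hnd
    · exact fun T hT => hT (_, _) (Multiset.mem_add.2 (.inr (Multiset.mem_singleton_self _)))

/-! ### Reductions of prenex forms -/

theorem Red.newList {P Q : Proc} (h : Red P Q) (bs : List (Name × Name)) :
    Red (newList bs P) (newList bs Q) := by
  induction bs with
  | nil => exact h
  | cons b bs ih => exact .new ih

/-- A process is reducible if it reduces to some process. -/
def Reducible (P : Proc) : Prop := ∃ Q, Red P Q

theorem Reducible.of_structEq {P Q : Proc} (h : StructEq P Q) (hQ : Reducible Q) :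
    Reducible P :=
  hQ.imp fun _ hR => .equiv h hR (.refl _)

theorem Reducible.newList {P : Proc} (h : Reducible P) (bs : List (Name × Name)) :
    Reducible (newList bs P) :=
  h.elim fun _ h => ⟨_, h.newList bs⟩

theorem reducible_swap {x x' : Name} {P : Proc} (h : Reducible (new x' x P)) :
    Reducible (new x x' P) :=
  h.of_structEq StructAxiom.new_swap.structEq

theorem reducible_comm {x x' : Name} {P Q : Proc} (h : Reducible (new x' x (par Q P))) :
    Reducible (new x x' (par P Q)) :=
  reducible_swap (h.of_structEq (.new StructAxiom.mix_comm.structEq))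

/-- Restrictions of a prenex form can be brought to the innermost position. -/
theorem reducible_newList {bs : List (Name × Name)} (hn : (boundNames bs).Nodup)
    {x x' : Name} (hb : (x, x') ∈ bs) {P : Proc} (h : Reducible (new x x' P)) :
    Reducible (newList bs P) := by
  have hp : bs.Perm (bs.erase (x, x') ++ [(x, x')]) :=
    (List.perm_cons_erase hb).trans (List.perm_append_singleton _ _).symm
  refine Reducible.of_structEq (structEq_newList_of_perm hp hn P) ?_
  rw [newList_append]
  exact h.newList _

/-- The link rule accepts any process beside the link, so neither typing nor linearity is needed:
move the channel innermost, the link to the front, and orient both. -/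
theorem reducible_link {bs : List (Name × Name)} (hn : (boundNames bs).Nodup) {Ps : List Proc}
    {x y : Name} (hl : link x y ∈ Ps) (hb : x ∈ boundNames bs ∨ y ∈ boundNames bs) :
    Reducible (newList bs (parList Ps)) := by
  classical
  have key (w z z' : Name) (h : StructEq (link x y) (link w z)) :
      Reducible (new z z' (parList Ps)) := by
    refine Reducible.of_structEq (.new ?_)
      ⟨_, Red.link (w := w) (P := parList (Ps.erase (link x y)))⟩
    exact .trans (structEq_parList_of_perm (List.perm_cons_erase hl))
      (.trans (structEq_parList_cons _ _) (.par h (.refl _)))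
  have key' (w z : Name) (h : StructEq (link x y) (link w z)) (hz : z ∈ boundNames bs) :
      Reducible (newList bs (parList Ps)) := by
    simp only [boundNames, List.mem_flatMap, List.mem_cons, List.not_mem_nil, or_false] at hz
    obtain ⟨⟨b, b'⟩, hb, rfl | rfl⟩ := hz
    · exact reducible_newList hn hb (key w _ _ h)
    · exact reducible_newList hn hb (reducible_swap (key w _ _ h))
  rcases hb with hb | hb
  · exact key' y x StructAxiom.link_comm.structEq hb
  · exact key' x y (.refl _) hb

theorem reducible_tensor_parr (x x' y y' : Name) (P R : Proc) :
    Reducible (new x x' (par (send x y P) (recv x' y' R))) := by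
  obtain ⟨z, hz⟩ := Infinite.exists_notMem_finset (P.fn ∪ R.fn ∪ {x, x', y, y'})
  obtain ⟨z', hz'⟩ := Infinite.exists_notMem_finset (P.fn ∪ R.fn ∪ {x, x', y, y', z})
  simp only [Finset.mem_union, Finset.mem_insert, Finset.mem_singleton, not_or] at hz hz'
  refine Reducible.of_structEq
    (.new (.par (AlphaStep.send (z := z) hz.1.1).structEq
      (AlphaStep.recv (z := z') hz'.1.2).structEq))
    ⟨_, Red.beta_tensor_parr ?_ ?_ ?_ ?_ ?_ ?_ ?_⟩
  · tauto
  · tauto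
  · tauto
  · tauto
  · tauto
  · rw [mem_fn_swap, Equiv.swap_apply_of_ne_of_ne (by tauto) (by tauto)]
    tauto
  · rw [mem_fn_swap, Equiv.swap_apply_of_ne_of_ne (by tauto) (by tauto)]
    tauto

/-- Head-typed processes acting on the two endpoints of a channel communicate. -/
theorem reducible_of_acts {T : Name → Ty} {P Q : Proc} {x x' : Name} (hP : HeadTyped T P)
    (hQ : HeadTyped T Q) (hx : x ∈ P.acts) (hx' : x' ∈ Q.acts) (hT : T x' = (T x).dual)
    (hlP : ∀ y z, P ≠ link y z) (hlQ : ∀ y z, Q ≠ link y z) :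
    Reducible (new x x' (par P Q)) := by
  cases P <;> simp only [HeadTyped, acts, Finset.mem_singleton, Finset.notMem_empty] at hP hx <;>
    first
    | exact absurd rfl (hlP _ _)
    | skip
  all_goals
    subst hx
    cases Q <;>
      simp only [HeadTyped, acts, Finset.mem_singleton, Finset.notMem_empty] at hQ hx' <;>
      first
      | exact absurd rfl (hlQ _ _)
      | skip
    all_goals
      subst hx'
      first
      | exact reducible_tensor_parr _ _ _ _ _ _
      | exact ⟨_, .beta_one_bot⟩
      | exact ⟨_, .beta_plus_with_left⟩
      | exact ⟨_, .beta_plus_with_right⟩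
      | exact reducible_comm (reducible_tensor_parr _ _ _ _ _ _)
      | exact reducible_comm ⟨_, .beta_one_bot⟩
      | exact reducible_comm ⟨_, .beta_plus_with_left⟩
      | exact reducible_comm ⟨_, .beta_plus_with_right⟩
      -- The remaining pairs of heads violate duality. In particular a partner of `absurd` would
      -- have type `zero`, which no head introduces.
      | (exfalso; cases hTx : T x <;> simp_all [Ty.dual])

theorem reducible_of_dual {bs : List (Name × Name)} (hn : (boundNames bs).Nodup) {T : Name → Ty}
    {Ps : List Proc} (hl : (parList Ps).Linear) (hh : ∀ R ∈ Ps, HeadTyped T R)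
    (hlink : ∀ y z, link y z ∈ Ps → y ∉ boundNames bs ∧ z ∉ boundNames bs)
    {x x' : Name} (hb : (x, x') ∈ bs) (hT : T x' = (T x).dual) {i j : Fin Ps.length}
    (hij : i ≠ j) (hi : x ∈ (Ps.get i).acts) (hj : x' ∈ (Ps.get j).acts) :
    Reducible (newList bs (parList Ps)) := by
  obtain ⟨Qs, hp⟩ : ∃ Qs, Ps.Perm (Ps.get i :: Ps.get j :: Qs) := by
    have h1 : Ps.Perm (Ps.get i :: Ps.eraseIdx i) := (List.getElem_cons_eraseIdx_perm i.2).symm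
    have h2 : Ps.get j ∈ Ps.eraseIdx i :=
      List.mem_eraseIdx_iff_getElem.2 ⟨j, j.2, fun h => hij (Fin.ext h.symm), rfl⟩
    obtain ⟨s, t, hst⟩ := List.append_of_mem h2
    exact ⟨s ++ t, h1.trans (.cons _ (hst ▸ List.perm_middle))⟩
  have hpw := (hp.pairwise_iff (R := fun P Q : Proc => Disjoint P.fn Q.fn) fun h => h.symm).1
    (linear_parList hl)
  have hmi := List.get_mem Ps i
  have hmj := List.get_mem Ps j
  generalize Ps.get i = P at *
  generalize Ps.get j = Q at *
  simp only [List.pairwise_cons, List.mem_cons] at hpw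
  have hmx : x ∈ boundNames bs ∧ x' ∈ boundNames bs :=
    ⟨List.mem_flatMap.2 ⟨_, hb, by simp⟩, List.mem_flatMap.2 ⟨_, hb, by simp⟩⟩
  have hlk (R : Proc) (hR : R ∈ Ps) (a : Name) (ha : a ∈ R.acts) (hab : a ∈ boundNames bs)
      (y z : Name) : R ≠ link y z := by
    rintro rfl
    have := hlink y z hR
    simp only [acts, Finset.mem_insert, Finset.mem_singleton] at ha
    rcases ha with rfl | rfl
    · exact this.1 hab
    · exact this.2 hab
  obtain ⟨R, hR⟩ := reducible_of_acts (hh P hmi) (hh Q hmj) hi hj hT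
    (hlk P hmi x hi hmx.1) (hlk Q hmj x' hj hmx.2)
  refine reducible_newList hn hb ?_
  -- The other components leave the scope of the channel: by linearity its endpoints, free in `P`
  -- and `Q`, are not free in them.
  have e : StructEq (parList Ps) (par (parList Qs) (par P Q)) :=
    .trans (structEq_parList_of_perm hp) <|
      .trans (.par (.refl _) (structEq_parList_cons _ _)) <|
      .trans StructAxiom.mix_assoc.structEq StructAxiom.mix_comm.structEq
  refine Reducible.of_structEq (.trans (.new e) (.trans
    (StructAxiom.scope_ext ?_ ?_).structEq StructAxiom.mix_comm.structEq)) ⟨_, .mix hR⟩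
  · intro h
    obtain ⟨R, hR, h⟩ := fn_parList.1 h
    exact Finset.disjoint_left.1 (hpw.1 R (.inr hR)) (acts_subset_fn _ hi) h
  · intro h
    obtain ⟨R, hR, h⟩ := fn_parList.1 h
    exact Finset.disjoint_left.1 (hpw.2.1 R hR) (acts_subset_fn _ hj) h

/-! ### Progress -/

theorem parList_replicate_halt (n : ℕ) : StructEq (parList (List.replicate n halt)) halt := by
  induction n with
  | zero => exact .refl _
  | succ n ih =>
    exact .trans (structEq_parList_cons _ _) (.trans (structEq_halt_par _) ih)

/-- A well-typed process is in canonical form or reduces. -/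
theorem Typed.progress {P : Proc} {G : HyperEnv} (hP : Typed P G) :
    Canonical P ∨ Reducible P := by
  obtain ⟨bs, Qs, T, ⟨hn, -, hh, hd⟩, he, -⟩ := hP.exists_isPrenex ∅
  -- A canonical form with n channels needs n + m + 1 components. Padding with n + 1 copies of `0`,
  -- harmless for every other condition, secures this with m = `Qs.length`.
  obtain ⟨Ps, hPs⟩ : ∃ Ps, Ps = Qs ++ List.replicate (bs.length + 1) halt := ⟨_, rfl⟩
  have hlen : Ps.length = bs.length + Qs.length + 1 := by simp [hPs]; omega
  replace hh : ∀ R ∈ Ps, HeadTyped T R := by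
    intro R hR
    rw [hPs, List.mem_append] at hR
    rcases hR with hR | hR
    · exact hh R hR
    · rw [List.eq_of_mem_replicate hR]
      trivial
  replace he : StructEq P (newList bs (parList Ps)) := by
    refine .trans he (StructEq.newList (.symm ?_) bs)
    rw [hPs]
    exact .trans (structEq_parList_append _ _)
      (.trans (.par (.refl _) (parList_replicate_halt _)) StructAxiom.mix_halt.structEq)
  have hl : (parList Ps).Linear :=
    (linear_newList _ _).1 (he.invariants.2.2.2.1 hP.invariants.2.2)
  by_cases hlink : ∀ y z, link y z ∈ Ps → y ∉ boundNames bs ∧ z ∉ boundNames bs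
  · by_cases hdual : ∀ x x', (x, x') ∈ bs → ∀ i j : Fin Ps.length, i ≠ j →
        ¬ (x ∈ (Ps.get i).acts ∧ x' ∈ (Ps.get j).acts)
    · exact .inl ⟨bs, Ps, ⟨hn, ⟨_, hlen⟩, fun x x' P h => hh _ h, fun P Q h => hh _ h, hlink,
        hdual⟩, he⟩
    · push Not at hdual
      obtain ⟨x, x', hb, i, j, hij, hi, hj⟩ := hdual
      exact .inr (.of_structEq he (reducible_of_dual hn hl hh hlink hb (hd _ hb) hij hi hj))
  · push Not at hlink
    obtain ⟨y, z, hyz, h⟩ := hlink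
    exact .inr (.of_structEq he (reducible_link hn hyz (by tauto)))

end HCP

theorem mainTheorem5 (P : HCP.Proc) (G : HCP.HyperEnv) (hP : HCP.Typed P G) :
    (HCP.Canonical P ∨ ∃ Q : HCP.Proc, HCP.Red P Q) ∧
    (G ≠ 0 → ∀ (bs : List (HCP.Name × HCP.Name)) (Ps : List HCP.Proc),
      HCP.IsCanonicalForm bs Ps →
      HCP.StructEq P (HCP.newList bs (HCP.parList Ps)) →
      ∃ R ∈ Ps, ∃ a ∈ R.acts, a ∉ HCP.boundNames bs) :=
  ⟨hP.progress, fun hG _ _ hc he => hP.exists_acts_free hG hc he⟩
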